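/- Let $S \subseteq \mathbb{R}^n$ be a semialgebraic set, and let $\dim S$ denote its dimension, that is, the Krull dimension of $\mathbb{R}[x_1,\dots,x_n]/I(S)$, where $I(S)$ is the ideal of the polynomials vanishing on $S$ (the empty set has dimension $<0$). Assume that $\dim S > 0$. If $h$ is a generic linear form $x \mapsto a_1x_1+\dots+a_nx_n$, $a \in \mathbb{R}^n$, or a generic squared distance function $x \mapsto \|x-p\|^2$, $p \in \mathbb{R}^n$, then $$\dim\big(S \cap h^{-1}(t)\big) < \dim S \qquad \text{for every } t \in \mathbb{R}.$$ Here "generic" means that there are nonzero polynomials $g_1, g_2 \in \mathbb{R}[x_1,\dots,x_n]$, depending only on $S$, such that the conclusion holds for every $a$ with $g_1(a) \neq 0$ and for every $p$ with $g_2(p) \neq 0$ (so on a nonempty Zariski open set of parameters, the same for all $t$). -/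

import Mathlib

/-- Semialgebraic subsets of `ℝⁿ`: the smallest family of subsets that contains all sets
`{x | f x > 0}`, for `f` a real polynomial in `n` variables, and that is closed under complements,
finite unions and finite intersections. -/
inductive IsSemialgebraic {n : ℕ} : Set (Fin n → ℝ) → Prop
  | pos (f : MvPolynomial (Fin n) ℝ) : IsSemialgebraic {x | 0 < MvPolynomial.eval x f}
  | compl {A : Set (Fin n → ℝ)} : IsSemialgebraic A → IsSemialgebraic Aᶜ
  | union {A B : Set (Fin n → ℝ)} :
      IsSemialgebraic A → IsSemialgebraic B → IsSemialgebraic (A ∪ B)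
  | inter {A B : Set (Fin n → ℝ)} :
      IsSemialgebraic A → IsSemialgebraic B → IsSemialgebraic (A ∩ B)

/-- The dimension of a semialgebraic set `S ⊆ ℝⁿ` (Bochnak, Coste, Roy): the Krull dimension of
the ring `ℝ[x₁, …, xₙ] / I(S)` of polynomial functions on `S`, where `I(S)` is the ideal of all
polynomials that vanish on `S`. The empty set has dimension `⊥`, which is below `0`. -/
noncomputable def semialgDim {n : ℕ} (S : Set (Fin n → ℝ)) : WithBot ℕ∞ :=
  ringKrullDim (MvPolynomial (Fin n) ℝ ⧸ MvPolynomial.vanishingIdeal ℝ S)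

/-- The linear form `x ↦ a₁ x₁ + ⋯ + aₙ xₙ` with coefficient vector `a`. -/
def linearForm {n : ℕ} (a : Fin n → ℝ) (x : Fin n → ℝ) : ℝ := ∑ i, a i * x i

/-- The squared Euclidean distance `x ↦ ‖x - p‖²` to the point `p`. -/
def sqDist {n : ℕ} (p : Fin n → ℝ) (x : Fin n → ℝ) : ℝ := ∑ i, (x i - p i) ^ 2

/-- `P` holds for a generic point of `ℝⁿ`: it holds on a nonempty Zariski open subset, that is,
outside the zero set of some nonzero polynomial. -/
def IsGenericProp {n : ℕ} (P : (Fin n → ℝ) → Prop) : Prop :=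
  ∃ g : MvPolynomial (Fin n) ℝ, g ≠ 0 ∧ ∀ a : Fin n → ℝ, MvPolynomial.eval a g ≠ 0 → P a

/-!
The argument is algebraic and works for an arbitrary `S ⊆ ℝⁿ`. Let `I = I(S)` and let `f` be a
polynomial vanishing on a further set `T`. If `dim (S ∩ T)` were at least `d = dim S`, a chain of
`d + 1` primes containing `I(S ∩ T)` would start at a minimal prime `P` of `I`, since otherwise a
minimal prime could be put in front of it. Then `f ∈ P` and `dim ℝ[x] / P ≥ d > 0`. So it is enough
that `f` avoids the finitely many minimal primes of `I` with positive-dimensional quotient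
(`semialgDim_inter_lt`).

For such a prime `P`, the vectors `a` whose linear form is congruent to a constant modulo `P` form a
linear subspace (`constSubmodule P`), which is proper: otherwise all coordinates are constant modulo
`P`, and `ℝ[x] / P` is a quotient of `ℝ`. Hence for `a` outside the union of these proper subspaces
no `∑ aᵢ xᵢ - t` lies in any such `P`. For squared distances, `‖x - p‖² - ‖x - q‖²` is, up to a
constant, the linear form of `-2 (p - q)`, so the `p` for which `‖x - p‖²` is constant modulo `P`
lie in a single translate of the same proper subspace.
-/

open MvPolynomial

/-! ### Krull dimension of quotients and minimal primes -/

/-- Passing to an ideal `J ⊇ I` lowers the dimension of the quotient if `J` contains an element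
outside every minimal prime of `I` whose quotient has positive dimension. -/
theorem ringKrullDim_quotient_lt_of_notMem_minimalPrimes {R : Type*} [CommRing R]
    [FiniteRingKrullDim R] {I J : Ideal R} (hIJ : I ≤ J) (hI : 0 < ringKrullDim (R ⧸ I))
    {f : R} (hfJ : f ∈ J)
    (hf : ∀ P ∈ I.minimalPrimes, 0 < ringKrullDim (R ⧸ P) → f ∉ P) :
    ringKrullDim (R ⧸ J) < ringKrullDim (R ⧸ I) := by
  obtain ⟨d, hd⟩ : ∃ d : ℕ, ringKrullDim (R ⧸ I) = d := by
    have htop : ringKrullDim (R ⧸ I) ≠ ⊤ :=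
      ((ringKrullDim_quotient_le I).trans_lt ringKrullDim_lt_top).ne
    generalize ringKrullDim (R ⧸ I) = e at hI htop
    induction e with
    | bot => simp at hI
    | coe e =>
      induction e with
      | top => exact absurd rfl htop
      | coe d => exact ⟨d, rfl⟩
  by_contra! hlt
  rw [hd] at hlt hI
  rw [ringKrullDim_quotient, Order.le_krullDim_iff] at hlt
  obtain ⟨l, hl⟩ := hlt
  obtain ⟨P, hPmin, hPl⟩ := Ideal.exists_minimalPrimes_le
    (hIJ.trans ((PrimeSpectrum.mem_zeroLocus _ _).1 l.head.2))
  have : P.IsPrime := hPmin.1.1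
  rcases hPl.eq_or_lt with heq | hlt
  · have hmem : ∀ Q : PrimeSpectrum.zeroLocus (J : Set R), l.head ≤ Q →
        Q.1 ∈ PrimeSpectrum.zeroLocus (P : Set R) := fun Q hQ => by
      rw [PrimeSpectrum.mem_zeroLocus, heq]
      exact hQ
    have hdP : (d : WithBot ℕ∞) ≤ ringKrullDim (R ⧸ P) := by
      rw [ringKrullDim_quotient, Order.le_krullDim_iff]
      exact ⟨⟨l.length, fun i => ⟨(l i).1, hmem _ (l.head_le i)⟩, fun i => l.step i⟩, hl⟩
    refine hf P hPmin (hI.trans_le hdP) ?_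
    rw [heq]
    exact l.head.2 hfJ
  · let l' : LTSeries (PrimeSpectrum.zeroLocus (I : Set R)) :=
      l.map (fun Q => ⟨Q.1, hIJ.trans Q.2⟩) (fun _ _ h => h)
    let P' : PrimeSpectrum.zeroLocus (I : Set R) := ⟨⟨P, this⟩, hPmin.1.2⟩
    have hP' : P' < l'.head := hlt
    have hle : ((d + 1 : ℕ) : WithBot ℕ∞) ≤ ringKrullDim (R ⧸ I) := by
      rw [ringKrullDim_quotient, Order.le_krullDim_iff]
      exact ⟨l'.cons P' hP', (RelSeries.cons_length _ _ _).trans (congrArg (· + 1) hl)⟩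
    rw [hd] at hle
    have : d + 1 ≤ d := by exact_mod_cast hle
    omega

theorem semialgDim_inter_lt {n : ℕ} {S T : Set (Fin n → ℝ)} (hdim : 0 < semialgDim S)
    {f : MvPolynomial (Fin n) ℝ} (hfT : ∀ x ∈ T, eval x f = 0)
    (hf : ∀ P ∈ (vanishingIdeal ℝ S).minimalPrimes,
      0 < ringKrullDim (MvPolynomial (Fin n) ℝ ⧸ P) → f ∉ P) :
    semialgDim (S ∩ T) < semialgDim S := by
  have : FiniteRingKrullDim (MvPolynomial (Fin n) ℝ) := by
    rw [finiteRingKrullDim_iff_ne_bot_and_top, ringKrullDim_of_isNoetherianRing,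
      ringKrullDim_eq_zero_of_field, zero_add]
    exact ⟨WithBot.coe_ne_bot, fun h => ENat.natCast_ne_top _ (WithBot.coe_injective h)⟩
  refine ringKrullDim_quotient_lt_of_notMem_minimalPrimes
    (vanishingIdeal_anti_mono Set.inter_subset_left) hdim (f := f) ?_ hf
  rw [mem_vanishingIdeal_iff]
  exact fun x hx => by simpa [aeval_def] using hfT x hx.2

/-! ### Generic properties -/

theorem IsGenericProp.mono {n : ℕ} {P Q : (Fin n → ℝ) → Prop} (hP : IsGenericProp P)
    (h : ∀ a, P a → Q a) : IsGenericProp Q :=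
  let ⟨g, hg, hgP⟩ := hP
  ⟨g, hg, fun a ha => h a (hgP a ha)⟩

theorem IsGenericProp.forall_mem_finite {n : ℕ} {ι : Type*} {s : Set ι} (hs : s.Finite)
    {P : ι → (Fin n → ℝ) → Prop} (h : ∀ i ∈ s, IsGenericProp (P i)) :
    IsGenericProp (fun a => ∀ i ∈ s, P i a) := by
  have := hs.fintype
  choose g hg hgP using fun i : s => h i i.2
  refine ⟨∏ i, g i, Finset.prod_ne_zero_iff.2 fun i _ => hg i, fun a ha i hi => ?_⟩
  rw [map_prod] at ha
  exact hgP ⟨i, hi⟩ a (Finset.prod_ne_zero_iff.1 ha ⟨i, hi⟩ (Finset.mem_univ _))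

theorem isGenericProp_sub_notMem {n : ℕ} {V : Submodule ℝ (Fin n → ℝ)} (hV : V ≠ ⊤)
    (q : Fin n → ℝ) : IsGenericProp (fun p => p - q ∉ V) := by
  obtain ⟨φ, hφ, hVφ⟩ := V.exists_le_ker_of_lt_top hV.lt_top
  let g : MvPolynomial (Fin n) ℝ := ∑ i, C (φ (Pi.single i 1)) * X i - C (φ q)
  have hg : ∀ p, eval p g = φ (p - q) := fun p => by
    have hp : φ p = ∑ i, p i * φ (Pi.single i 1) := by
      conv_lhs => rw [pi_eq_sum_univ' p]
      simp [map_sum]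
    simp [g, hp, mul_comm]
  refine ⟨g, fun h0 => hφ ?_, fun p hp hmem => hp ?_⟩
  · refine LinearMap.ext fun v => ?_
    simpa [h0] using (hg (v + q)).symm
  · rw [hg]
    exact hVφ hmem

/-! ### Linear forms constant modulo an ideal -/

/-- The linear form with coefficient vector `a`, as a polynomial. -/
noncomputable def linearPoly {n : ℕ} (a : Fin n → ℝ) : MvPolynomial (Fin n) ℝ :=
  ∑ i, C (a i) * X i

/-- The squared distance to the point `p`, as a polynomial. -/
noncomputable def sqDistPoly {n : ℕ} (p : Fin n → ℝ) : MvPolynomial (Fin n) ℝ :=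
  ∑ i, (X i - C (p i)) ^ 2

theorem eval_linearPoly {n : ℕ} (a x : Fin n → ℝ) : eval x (linearPoly a) = linearForm a x := by
  simp [linearPoly, linearForm]

theorem eval_sqDistPoly {n : ℕ} (p x : Fin n → ℝ) : eval x (sqDistPoly p) = sqDist p x := by
  simp [sqDistPoly, sqDist]

/-- The space of coefficient vectors whose linear form is congruent to a constant modulo `P`. -/
def constSubmodule {n : ℕ} (P : Ideal (MvPolynomial (Fin n) ℝ)) : Submodule ℝ (Fin n → ℝ) where
  carrier := {a | ∃ t : ℝ, linearPoly a - C t ∈ P}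
  zero_mem' := ⟨0, by simp [linearPoly]⟩
  add_mem' := by
    rintro a b ⟨s, hs⟩ ⟨t, ht⟩
    refine ⟨s + t, ?_⟩
    convert P.add_mem hs ht using 1
    simp only [linearPoly, Pi.add_apply, map_add, add_mul, Finset.sum_add_distrib]
    ring
  smul_mem' := by
    rintro c a ⟨t, ht⟩
    refine ⟨c * t, ?_⟩
    convert P.mul_mem_left (C c) ht using 1
    simp only [linearPoly, Pi.smul_apply, smul_eq_mul, map_mul, mul_sub, Finset.mul_sum, mul_assoc]

theorem mem_constSubmodule {n : ℕ} {P : Ideal (MvPolynomial (Fin n) ℝ)} {a : Fin n → ℝ} :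
    a ∈ constSubmodule P ↔ ∃ t : ℝ, linearPoly a - C t ∈ P :=
  Iff.rfl

theorem constSubmodule_ne_top {n : ℕ} {P : Ideal (MvPolynomial (Fin n) ℝ)}
    (hP : 0 < ringKrullDim (MvPolynomial (Fin n) ℝ ⧸ P)) : constSubmodule P ≠ ⊤ := by
  intro htop
  have hX : ∀ i, ∃ t : ℝ, X i - C t ∈ P := fun i => by
    obtain ⟨t, ht⟩ := mem_constSubmodule.1 (htop ▸ Submodule.mem_top :
      (Pi.single i 1 : Fin n → ℝ) ∈ constSubmodule P)
    refine ⟨t, ?_⟩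
    simpa [linearPoly, Pi.single_apply, ite_mul, apply_ite] using ht
  choose t ht using hX
  have hC : ∀ f : MvPolynomial (Fin n) ℝ,
      Ideal.Quotient.mk P f = Ideal.Quotient.mk P (C (eval t f)) := fun f => by
    induction f using MvPolynomial.induction_on with
    | C c => simp
    | add f g hf hg => simp only [map_add, hf, hg]
    | mul_X f i hf =>
      rw [map_mul, hf, (Ideal.Quotient.mk_eq_mk_iff_sub_mem _ _).2 (ht i)]
      simp only [map_mul, eval_X]
  have hsurj : Function.Surjective
      ((Ideal.Quotient.mk P).comp (C : ℝ →+* MvPolynomial (Fin n) ℝ)) := fun y => by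
    obtain ⟨f, rfl⟩ := Ideal.Quotient.mk_surjective y
    exact ⟨eval t f, (hC f).symm⟩
  have hle := ringKrullDim_le_of_surjective _ hsurj
  rw [ringKrullDim_eq_zero_of_field] at hle
  exact hle.not_gt hP

theorem isGenericProp_linearPoly_sub_C_notMem {n : ℕ} {P : Ideal (MvPolynomial (Fin n) ℝ)}
    (hP : 0 < ringKrullDim (MvPolynomial (Fin n) ℝ ⧸ P)) :
    IsGenericProp (fun a : Fin n → ℝ => ∀ t : ℝ, linearPoly a - C t ∉ P) :=
  (isGenericProp_sub_notMem (constSubmodule_ne_top hP) 0).mono fun a ha t ht =>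
    ha (by simpa using mem_constSubmodule.2 ⟨t, ht⟩)

/-- Two points whose squared distance functions are both constant modulo `P` differ by a vector
whose linear form is constant modulo `P`. -/
theorem sub_mem_constSubmodule {n : ℕ} {P : Ideal (MvPolynomial (Fin n) ℝ)} {p q : Fin n → ℝ}
    {s t : ℝ} (hp : sqDistPoly p - C s ∈ P) (hq : sqDistPoly q - C t ∈ P) :
    p - q ∈ constSubmodule P := by
  have hmem : (-2 : ℝ) • (p - q) ∈ constSubmodule P := by
    refine mem_constSubmodule.2 ⟨(s - t) - (∑ i, p i ^ 2 - ∑ i, q i ^ 2), ?_⟩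
    convert P.sub_mem hp hq using 1
    have hsum : sqDistPoly p - sqDistPoly q = linearPoly ((-2 : ℝ) • (p - q)) +
        (∑ i, C (p i) ^ 2 - ∑ i, C (q i) ^ 2) := by
      simp only [sqDistPoly, linearPoly, ← Finset.sum_sub_distrib, ← Finset.sum_add_distrib]
      refine Finset.sum_congr rfl fun i _ => ?_
      simp only [Pi.smul_apply, Pi.sub_apply, smul_eq_mul, map_mul, map_sub, map_neg, map_ofNat]
      ring
    simp only [map_sub, map_sum, map_pow]
    linear_combination -hsum
  exact (Submodule.smul_mem_iff _ (by norm_num)).1 hmem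

theorem isGenericProp_sqDistPoly_sub_C_notMem {n : ℕ} {P : Ideal (MvPolynomial (Fin n) ℝ)}
    (hP : 0 < ringKrullDim (MvPolynomial (Fin n) ℝ ⧸ P)) :
    IsGenericProp (fun p : Fin n → ℝ => ∀ t : ℝ, sqDistPoly p - C t ∉ P) := by
  by_cases h : ∃ (q : Fin n → ℝ) (t : ℝ), sqDistPoly q - C t ∈ P
  · obtain ⟨q, t, hq⟩ := h
    exact (isGenericProp_sub_notMem (constSubmodule_ne_top hP) q).mono fun p hp s hs =>
      hp (sub_mem_constSubmodule hs hq)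
  · exact ⟨1, one_ne_zero, fun p _ t ht => h ⟨p, t, ht⟩⟩

/-! ### Generic level sets -/

/-- A parametrized family of polynomials `F a` has dimension-dropping level sets on `S` for generic
`a` if, modulo each prime of positive-dimensional quotient, a generic `F a` is not constant. -/
theorem isGenericProp_semialgDim_inter_lt {n : ℕ} {S : Set (Fin n → ℝ)} (hdim : 0 < semialgDim S)
    {F : (Fin n → ℝ) → MvPolynomial (Fin n) ℝ} {h : (Fin n → ℝ) → (Fin n → ℝ) → ℝ}
    (hFh : ∀ a x, eval x (F a) = h a x)
    (hF : ∀ P : Ideal (MvPolynomial (Fin n) ℝ), 0 < ringKrullDim (MvPolynomial (Fin n) ℝ ⧸ P) →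
      IsGenericProp (fun a => ∀ t : ℝ, F a - C t ∉ P)) :
    IsGenericProp (fun a => ∀ t : ℝ, semialgDim (S ∩ {x | h a x = t}) < semialgDim S) := by
  have hfin : {P ∈ (vanishingIdeal ℝ S).minimalPrimes |
      0 < ringKrullDim (MvPolynomial (Fin n) ℝ ⧸ P)}.Finite :=
    (Ideal.finite_minimalPrimes_of_isNoetherianRing _ _).subset (Set.sep_subset _ _)
  refine (IsGenericProp.forall_mem_finite hfin fun P hP => hF P hP.2).mono fun a ha t => ?_
  refine semialgDim_inter_lt hdim (f := F a - C t) (fun x hx => ?_)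
    fun P hP hPdim => ha P ⟨hP, hPdim⟩ t
  rw [map_sub, eval_C, hFh, sub_eq_zero]
  exact hx

theorem mainTheorem7 (n : ℕ) (S : Set (Fin n → ℝ)) (hS : IsSemialgebraic S)
    (hdim : 0 < semialgDim S) :
    IsGenericProp (fun a : Fin n → ℝ =>
      ∀ t : ℝ, semialgDim (S ∩ {x | linearForm a x = t}) < semialgDim S) ∧
    IsGenericProp (fun p : Fin n → ℝ =>
      ∀ t : ℝ, semialgDim (S ∩ {x | sqDist p x = t}) < semialgDim S) :=
  ⟨isGenericProp_semialgDim_inter_lt hdim eval_linearPoly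
      fun _ => isGenericProp_linearPoly_sub_C_notMem,
    isGenericProp_semialgDim_inter_lt hdim eval_sqDistPoly
      fun _ => isGenericProp_sqDistPoly_sub_C_notMem⟩
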